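/- Lemma 4.2. Conventions. Let $F$ be a finite field with $q$ elements and characteristic $p$. All groups and modules are finite, and a module $W$ for a group $H$ is coprime if $(|H|,|W|)=1$. Modules need not be faithful unless this is said. For an $FG$-module $V$ let $n(G,V)$ be the number of orbits of $G$ on the set $V$. Let $W$ be a coprime $QH$-module, where $Q$ is a finite field extension of $F$, and let $\psi:H\to GL_Q(W)$ be the corresponding homomorphism. For a field $Q_1$ with $F\le Q_1\le Q$, $\mathrm{Stab}_{Q_1}^{Q}(H,W)$ is the class of pairs $(H_1,W_1)$, where $W_1$ is $W$ viewed as a $Q_1$-vector space and $H_1$ is a group with $W_1$ a coprime $Q_1H_1$-module, such that the corresponding homomorphism $\varphi:H_1\to GL_{Q_1}(W_1)$ has the following properties: every $\varphi(h)$ is $Q$-semilinear (that is, there is $\sigma\in\mathrm{Gal}(Q/Q_1)$ with $\varphi(h)(aw)=\sigma(a)\varphi(h)(w)$ for all $a\in Q$, $w\in W$), and $\varphi(H_1)\cap GL_Q(W)=\psi(H)$. Further, $\mathrm{Ind}(H,W)$ is the class of pairs $(H_1,W_1)$ where $H_1$ is a group with $H\le H_1$ and $W_1\cong\mathrm{Ind}_H^{H_1}(W)$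 is a coprime $QH_1$-module. Let $\mathcal C_q$ be the class of pairs $(G,V)$ such that $V$ is a finite, faithful, coprime and irreducible $FG$-module and $(G,V)$ can be obtained by repeated (possibly no) applications of $\mathrm{Stab}$ and $\mathrm{Ind}$, starting with a pair $(H,W)$ where $W$ is a coprime $1$-dimensional $QH$-module for some finite field extension $Q$ of $F$. Statement. Let $(G,V)\in\mathcal C_q$ with $n(G,V)<2\sqrt{q-1}$ and suppose that $p\ge 59$. Then at least one of the following holds. (1) $G$ has an abelian subgroup of index at most $|V|^{1/2}/(2\sqrt{p-1})$. (2) $|F|=p$, the module $V$ is induced from a $1$-dimensional $FH$-module for some subgroup $H\le G$, and $G$ has a factor group isomorphic to $A_n$ or $S_n$, where $n=\dim_F(V)$. Moreover, in this case either $n=1$, or $15\le n\le 180$ and $p<8192$. -/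

import Mathlib

universe u v w

/-- The number `n(G, V)` of orbits of `G` on `V`; the orbit of `x` is `{ρ g x | g ∈ G}`. -/
noncomputable def numOrbits {F : Type u} {G : Type v} {V : Type w} [Field F] [Group G]
    [AddCommGroup V] [Module F V] (ρ : Representation F G V) : ℕ :=
  (Set.range fun x : V => Set.range fun g : G => ρ g x).ncard

/-- `(H₁, W) ∈ Stab_{Q₁}^{Q}(H, W)`. Here `ρ` is the `Q`-linear action `ψ` of `H` on `W`, and `ρ₁`
is the `Q₁`-linear action `φ` of `H₁` on the same `W`, viewed as a vector space over the
subfield `Q₁` of `Q`. The group `H₁` acts by `Q`-semilinear maps (it stabilizes the `Q`-structure),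
and the maps in `φ(H₁)` that are `Q`-linear are exactly the maps in `ψ(H)`. -/
def IsStab (Q₁ Q : Type u) {H₁ H : Type v} {W : Type w} [Field Q₁] [Field Q] [Algebra Q₁ Q]
    [Group H₁] [Group H] [AddCommGroup W] [Module Q₁ W] [Module Q W] [IsScalarTower Q₁ Q W]
    (ρ₁ : Representation Q₁ H₁ W) (ρ : Representation Q H W) : Prop :=
  (∀ h : H₁, ∃ τ : Q ≃ₐ[Q₁] Q, ∀ (a : Q) (x : W), ρ₁ h (a • x) = τ a • ρ₁ h x) ∧
    ∀ T : Module.End Q W, (∃ h : H₁, ρ₁ h = T.restrictScalars Q₁) ↔ ∃ h : H, ρ h = T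

/-- `(H₁, W₁) ∈ Ind(H, W)` for a subgroup `H` of `H₁`: the module `W₁` is (isomorphic to) the
module induced from the `H`-module `W`. -/
def IsInd {Q : Type u} {H₁ : Type v} {W₁ W : Type w} [Field Q] [Group H₁] {H : Subgroup H₁}
    [AddCommGroup W₁] [Module Q W₁] [AddCommGroup W] [Module Q W]
    (ρ₁ : Representation Q H₁ W₁) (ρ : Representation Q H W) : Prop :=
  Nonempty (ρ₁.Equiv (Representation.ind H.subtype ρ))

/-- The pairs `(H, W)`, with `W` a not necessarily faithful coprime `QH`-module for a finite field
extension `Q` of `F`, that are obtained from a `1`-dimensional module over some finite extension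
field of `F` by repeated applications of `Stab` and `Ind`. -/
inductive Obtainable (F : Type u) [Field F] :
    ∀ (Q : Type u) [Field Q] [Algebra F Q] {H : Type v} [Group H] {W : Type w} [AddCommGroup W]
      [Module Q W], Representation Q H W → Prop
  | line (Q : Type u) [Field Q] [Finite Q] [Algebra F Q] {H : Type v} [Group H] [Finite H]
      {W : Type w} [AddCommGroup W] [Module Q W] (ρ : Representation Q H W)
      (hcop : (Nat.card H).Coprime (Nat.card W))
      (hdim : Module.finrank Q W = 1) :
      Obtainable F Q ρ
  | stab (Q₁ Q : Type u) [Field Q₁] [Field Q] [Algebra F Q₁] [Algebra F Q] [Algebra Q₁ Q]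
      [IsScalarTower F Q₁ Q] {H₁ H : Type v} [Group H₁] [Finite H₁] [Group H] {W : Type w}
      [AddCommGroup W] [Module Q₁ W] [Module Q W] [IsScalarTower Q₁ Q W]
      (ρ₁ : Representation Q₁ H₁ W) (ρ : Representation Q H W)
      (hcop : (Nat.card H₁).Coprime (Nat.card W))
      (hstab : IsStab Q₁ Q ρ₁ ρ) (h : Obtainable F Q ρ) :
      Obtainable F Q₁ ρ₁
  | ind (Q : Type u) [Field Q] [Algebra F Q] {H₁ : Type v} [Group H₁] [Finite H₁]
      {H : Subgroup H₁} {W₁ W : Type w} [AddCommGroup W₁] [Module Q W₁] [AddCommGroup W]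
      [Module Q W] (ρ₁ : Representation Q H₁ W₁) (ρ : Representation Q H W)
      (hcop : (Nat.card H₁).Coprime (Nat.card W₁))
      (hind : IsInd ρ₁ ρ) (h : Obtainable F Q ρ) :
      Obtainable F Q ρ₁

/-- The class `𝒞_q` over the field `F` with `q` elements: `V` is a finite, faithful, coprime and
irreducible `FG`-module such that `(G, V)` is obtained by repeated applications of `Stab` and `Ind`
from a `1`-dimensional module over a field extension of `F`. -/
structure InClassC {F : Type u} {G : Type v} {V : Type w} [Field F] [Group G] [AddCommGroup V]
    [Module F V] (ρ : Representation F G V) : Prop where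
  finite : Finite V
  faithful : Function.Injective ρ
  coprime : (Nat.card G).Coprime (Nat.card V)
  irreducible : ρ.IsIrreducible
  obtainable : Obtainable F F ρ

/-- The module `V` is induced from a `1`-dimensional `FH`-module for some subgroup `H ≤ G`. -/
def IsInducedFromLine {F : Type u} {G : Type v} {V : Type w} [Field F] [Group G] [AddCommGroup V]
    [Module F V] (ρ : Representation F G V) : Prop :=
  ∃ (H : Subgroup G) (W : Type w) (_ : AddCommGroup W) (_ : Module F W) (σ : Representation F H W),
    Module.finrank F W = 1 ∧ IsInd ρ σ

/-!
Call `(H, W)` over `Q` *good* if either `|W| = |Q|`, or some subgroup `A ≤ H` acts on `W` by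
commuting maps and `4 |Q| |H : A|² ≤ |W|`. The theorem follows from the claim that every obtainable
pair over a field `Q` with `|Q| ≥ 59` and `n(H, W) < 2 √(|Q| - 1)` is good
(`card_eq_or_hasLargeCommutingSubgroup`). For `(G, V)` itself faithfulness turns a commuting
subgroup into an abelian one, `|F| ≥ p` gives the index required in alternative (1), and `|V| = |F|`
means that `V` is a line: then `G` is abelian, which is (1) if `|F| ≥ p²` and (2) with `n = 1` if
`|F| = p`. The alternative `15 ≤ n ≤ 180` is not needed: the orbit bound always forces (1)
when `n ≥ 2`.

The claim is proved by induction along the construction. Squaring, the orbit hypothesis reads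
`n(H, W)² + 4 < 4 |Q|`, and it passes from the constructed pair to the pair it is built from.

* `Stab`, with `d = [Q : Q₁]`: an orbit of `H₁` splits into at most `d` orbits of `H`
  (`IsStab.numOrbits_le`), and `d² (|Q₁| - 1) ≤ |Q₁|^d - 1`. A commuting subgroup of `H` gives one
  of `H₁` whose index is at most `d` times larger (`IsStab.exists_commuting_subgroup`), and this
  factor is absorbed by `d² ≤ |Q₁|^(d-1)`.
* `Ind`, with `t = |H₁ : H|`: `W₁` is a sum of `t` blocks permuted by `H₁`, so that
  `n(H, W) ≤ n(H₁, W₁)`; and the number of non-zero block components is an invariant of the orbit,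
  so that also `t + 1 ≤ n(H₁, W₁)` (`index_lt_numOrbits_of_isInd`). A commuting subgroup of index
  `a` in `H` gives one of index at most `a^t t!` in `H₁`
  (`exists_commuting_subgroup_of_isInd`). Since `t` is small compared with `√|Q|`, the factor `t!`
  is harmless: `t!² ≤ (4 |Q|)^(t-1)` when `W` is not a line, and `4 t!² ≤ |Q|^(t-1)` when it is and
  `t ≥ 2` (`four_mul_sq_factorial_le`).
-/

/-! ### Numerical estimates -/

lemma four_mul_sq_factorial_le_of_le {t : ℕ} (h2 : 2 ≤ t) (h14 : t ≤ 14) :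
    4 * t.factorial ^ 2 ≤ 59 ^ (t - 1) := by
  interval_cases t <;> decide

/-- The first three terms of the binomial expansion of `(a + 1) ^ n`, multiplied by `2 a²`. -/
lemma sum_three_binomial_terms_le (a n : ℕ) :
    a ^ n * (2 * a ^ 2 + 2 * n * a + n * (n - 1) : ℤ) ≤ 2 * (a + 1) ^ n * a ^ 2 := by
  induction n with
  | zero => simp
  | succ n ih =>
    have h1 : (0 : ℤ) ≤ a ^ n * (n * (n - 1)) := by
      rcases n with _ | n
      · simp
      · push_cast; rw [add_sub_cancel_right]; positivity
    have h2 := mul_le_mul_of_nonneg_right ih (by positivity : (0 : ℤ) ≤ a + 1)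
    rw [pow_succ (a : ℤ) n, pow_succ (a + 1 : ℤ) n]
    push_cast
    linarith

lemma two_mul_pow_le_succ_pow {t : ℕ} (ht : 4 ≤ t) : 2 * (t + 1) ^ t ≤ (t + 2) ^ t := by
  have h := sum_three_binomial_terms_le (t + 1) t
  have h4 : (4 : ℤ) ≤ t := by exact_mod_cast ht
  have h1 : (2 * (t + 1) ^ t * (2 * (t + 1) ^ 2) : ℤ) ≤ (t + 2) ^ t * (2 * (t + 1) ^ 2) := by
    calc (2 * (t + 1) ^ t * (2 * (t + 1) ^ 2) : ℤ) = (t + 1) ^ t * (4 * (t + 1) ^ 2) := by ring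
      _ ≤ (t + 1) ^ t * (2 * (t + 1) ^ 2 + 2 * t * (t + 1) + t * (t - 1)) := by
          gcongr; nlinarith
      _ ≤ 2 * ((t + 1) + 1) ^ t * (t + 1) ^ 2 := by exact_mod_cast h
      _ = _ := by ring
  exact_mod_cast le_of_mul_le_mul_right h1 (by positivity)

lemma factorial_mul_two_pow_le {t : ℕ} (ht : 15 ≤ t) :
    t.factorial * 2 ^ t ≤ (t + 1) ^ (t - 1) := by
  induction t, ht using Nat.le_induction with
  | base => decide
  | succ t ht ih =>
    have h := two_mul_pow_le_succ_pow (t := t) (by omega)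
    calc (t + 1).factorial * 2 ^ (t + 1) = 2 * (t + 1) * (t.factorial * 2 ^ t) := by
          rw [Nat.factorial_succ]; ring
      _ ≤ 2 * (t + 1) * (t + 1) ^ (t - 1) := by gcongr
      _ = 2 * (t + 1) ^ t := by
          obtain ⟨s, rfl⟩ : ∃ s, t = s + 1 := ⟨t - 1, by omega⟩
          simp only [Nat.add_sub_cancel]; ring
      _ ≤ _ := h

/-- Both lower bounds on `c` are needed: for `t ≤ 14` the bound `c ≥ 59` suffices, beyond that
`c` has to grow with `t`. -/
lemma four_mul_sq_factorial_le {t c : ℕ} (h2 : 2 ≤ t) (hc : 59 ≤ c)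
    (ht : (t + 1) ^ 2 + 4 < 4 * c) : 4 * t.factorial ^ 2 ≤ c ^ (t - 1) := by
  rcases le_or_gt t 14 with h | h
  · exact (four_mul_sq_factorial_le_of_le h2 h).trans (Nat.pow_le_pow_left hc _)
  -- Here `c > (t + 1)² / 4`, so that `4 ^ (t - 1) * c ^ (t - 1) ≥ (t + 1) ^ (2 * (t - 1))`.
  · have h1 := factorial_mul_two_pow_le (t := t) h
    have h3 : ((t + 1) ^ 2) ^ (t - 1) ≤ (4 * c) ^ (t - 1) := Nat.pow_le_pow_left (by omega) _
    have h4 : (t.factorial * 2 ^ t) ^ 2 ≤ ((t + 1) ^ (t - 1)) ^ 2 := Nat.pow_le_pow_left h1 _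
    rw [← pow_mul, mul_comm 2, pow_mul, mul_pow] at h3
    have h5 : (t.factorial * 2 ^ t) ^ 2 = 4 ^ (t - 1) * (4 * t.factorial ^ 2) := by
      obtain ⟨s, rfl⟩ : ∃ s, t = s + 1 := ⟨t - 1, by omega⟩
      have : (4 : ℕ) ^ s = (2 ^ s) ^ 2 := by rw [← pow_mul, mul_comm, pow_mul]; norm_num
      simp only [Nat.add_sub_cancel, this]; ring
    exact Nat.le_of_mul_le_mul_left ((h5 ▸ h4).trans h3) (by positivity)

lemma sq_factorial_le {t c : ℕ} (ht : (t + 1) ^ 2 + 4 < 4 * c) :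
    t.factorial ^ 2 ≤ (4 * c) ^ (t - 1) := by
  have h1 : t.factorial ≤ t ^ (t - 1) := by
    rcases t with _ | s
    · simp
    · rw [Nat.factorial_succ, Nat.add_sub_cancel]
      clear ht
      induction s with
      | zero => simp
      | succ s ih =>
        rw [Nat.factorial_succ, pow_succ']
        gcongr
        exact ih.trans (by gcongr; omega)
  calc t.factorial ^ 2 ≤ (t ^ (t - 1)) ^ 2 := by gcongr
    _ = (t ^ 2) ^ (t - 1) := by rw [← pow_mul, ← pow_mul, mul_comm]
    _ ≤ _ := by refine Nat.pow_le_pow_left ?_ _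
                have : (t + 1) ^ 2 = t ^ 2 + 2 * t + 1 := by ring
                omega

lemma sq_mul_le_pow {C : ℕ} (hC : 2 ≤ C) (d : ℕ) : d ^ 2 * C + 1 ≤ (C + 1) ^ d := by
  induction d with
  | zero => simp
  | succ d ih =>
    have : 2 * d * C ≤ d ^ 2 * C ^ 2 := by
      rcases d with _ | d
      · simp
      · nlinarith [Nat.zero_le (d * C), Nat.mul_le_mul hC hC]
    calc (d + 1) ^ 2 * C + 1 ≤ (d ^ 2 * C + 1) * (C + 1) := by nlinarith
      _ ≤ (C + 1) ^ d * (C + 1) := by gcongr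
      _ = _ := (pow_succ _ _).symm

lemma sq_le_pow_pred {c d : ℕ} (hc : 4 ≤ c) (hd : 1 ≤ d) : d ^ 2 ≤ c ^ (d - 1) := by
  obtain ⟨s, rfl⟩ : ∃ s, d = s + 1 := ⟨d - 1, by omega⟩
  rw [Nat.add_sub_cancel]
  induction s with
  | zero => simp
  | succ s ih => rw [pow_succ c]; nlinarith [ih (by omega)]

lemma four_mul_sq_le_pow_pred {c d : ℕ} (hc : 16 ≤ c) (hd : 2 ≤ d) :
    4 * d ^ 2 ≤ c ^ (d - 1) := by
  obtain ⟨s, rfl⟩ : ∃ s, d = s + 2 := ⟨d - 2, by omega⟩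
  simp only [Nat.reduceSubDiff]
  induction s with
  | zero => simpa using hc
  | succ s ih => rw [pow_succ c]; nlinarith [ih (by omega)]

/-! ### Indices and orbits by counting labels -/

/-- If the label `f g` determines the coset `g A`, the index of `A` is at most the number of labels.
-/
lemma Subgroup.index_le_card_of_map {G : Type*} [Group G] (A : Subgroup G) {X : Type*} [Finite X]
    (f : G → X) (h : ∀ g g', f g = f g' → g⁻¹ * g' ∈ A) : A.index ≤ Nat.card X := by
  refine Nat.card_le_card_of_injective (fun i : G ⧸ A => f i.out) fun i j hij => ?_
  rw [← i.out_eq', ← j.out_eq']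
  exact QuotientGroup.eq.2 (h _ _ hij)

section Orbits

variable {F : Type*} {G : Type*} {V : Type*} [Field F] [Group G]
    [AddCommGroup V] [Module F V] (ρ : Representation F G V)

lemma range_orbit_eq_iff {x y : V} :
    (Set.range fun g => ρ g x) = (Set.range fun g => ρ g y) ↔ ∃ g, ρ g x = y := by
  constructor
  · intro h
    have : y ∈ Set.range fun g => ρ g y := ⟨1, by simp⟩
    rwa [← h] at this
  · rintro ⟨g, rfl⟩
    ext z
    constructor
    · rintro ⟨k, rfl⟩
      exact ⟨k * g⁻¹, by simp [← Module.End.mul_apply, ← map_mul]⟩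
    · rintro ⟨k, rfl⟩
      exact ⟨k * g, by simp⟩

/-- If equal labels only occur within an orbit, there are at most as many orbits as labels. -/
lemma numOrbits_le_card {X : Type*} [Finite X] (f : V → X)
    (h : ∀ x y, f x = f y → ∃ g, ρ g x = y) : numOrbits ρ ≤ Nat.card X := by
  rw [numOrbits, ← Nat.card_coe_set_eq]
  refine Nat.card_le_card_of_injective (fun O => f O.2.choose) fun O O' hO => ?_
  have := (range_orbit_eq_iff ρ).2 (h _ _ hO)
  exact Subtype.ext (by rw [← O.2.choose_spec, ← O'.2.choose_spec]; exact this)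

/-- Every invariant function takes at most as many values as there are orbits. -/
lemma card_range_le_numOrbits [Finite V] {X : Type*} (f : V → X) (h : ∀ g x, f (ρ g x) = f x) :
    (Set.range f).ncard ≤ numOrbits ρ := by
  have hfin : (Set.range fun x : V => Set.range fun g : G => ρ g x).Finite := Set.finite_range _
  have hS : ∀ y : Set.range f, ∃ x, f x = y := fun y => y.2
  choose s hs using hS
  rw [numOrbits, ← Nat.card_coe_set_eq, ← Nat.card_coe_set_eq]
  have := hfin.to_subtype
  refine Nat.card_le_card_of_injective
    (fun y => (⟨_, s y, rfl⟩ : Set.range fun x : V => Set.range fun g : G => ρ g x)) ?_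
  intro y z hyz
  obtain ⟨g, hg⟩ := (range_orbit_eq_iff ρ).1 (congrArg Subtype.val hyz)
  exact Subtype.ext (by rw [← hs y, ← hs z, ← hg, h])

end Orbits

/-! ### Induced modules as functions on cosets -/

section Induced

variable {Q : Type u} {G : Type v} [Field Q] [Group G] {H : Subgroup G} {W : Type w}
  [AddCommGroup W] [Module Q W]

/-- For a subgroup of finite index, induction and coinduction agree. This is `Rep.indCoindIso`
without its restriction on universes. -/
noncomputable def indEquivCoind [H.FiniteIndex] (ρ : Representation Q H W) :
    (Representation.ind H.subtype ρ).Equiv (Representation.coind H.subtype ρ) := by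
  classical
  exact .mk (.ofLinearMap (Rep.indToCoind (Rep.of ρ)) (Rep.coindToInd (Rep.of ρ))
    (Rep.coindToInd_indToCoind (Rep.of ρ)) (Rep.indToCoind_coindToInd (Rep.of ρ)))
    fun g ↦ by
      ext x a y
      simp
      exact Rep.indToCoindAux_fst_mul_inv (A := Rep.of ρ) x g y a

/-- The element of `H` by which `g` carries the block of the coset `i` to the block of `g • i`, in
terms of the representatives `Quotient.out`: it is the `h` with `g * i.out = (g • i).out * h`. -/
noncomputable def transition (H : Subgroup G) (g : G) (i : G ⧸ H) : H :=
  ⟨(g • i).out⁻¹ * (g * i.out), QuotientGroup.eq.1 <| by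
    rw [QuotientGroup.out_eq', ← smul_eq_mul, ← MulAction.Quotient.smul_coe,
      QuotientGroup.out_eq']⟩

/-- An induced module is the set of functions on `G ⧸ H` with values in `W`: the group permutes the
blocks and acts inside them through `transition`. The function belonging to an element `φ` of the
coinduced module is `i ↦ φ (i.out⁻¹)`. -/
lemma exists_equiv_of_isInd [H.FiniteIndex] {V : Type w} [AddCommGroup V] [Module Q V]
    {ρ₁ : Representation Q G V}
    {ρ : Representation Q H W} (h : IsInd ρ₁ ρ) :
    ∃ e : V ≃ (G ⧸ H → W), ∀ g v i, e (ρ₁ g v) (g • i) = ρ (transition H g i) (e v i) := by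
  obtain ⟨e⟩ := h
  let e₁ := e.trans (indEquivCoind ρ)
  let f : Representation.coindV H.subtype ρ → (G ⧸ H → W) := fun φ i => φ.1 i.out⁻¹
  have hx (x : G) (i : G ⧸ H) (hi : ((x⁻¹ : G) : G ⧸ H) = i) : x * i.out ∈ H := by
    have := QuotientGroup.eq.1 (hi.trans i.out_eq'.symm)
    simpa using this
  have hf : Function.Bijective f := by
    constructor
    · intro φ ψ h
      refine Subtype.ext (funext fun x => ?_)
      have h1 := φ.2 ⟨_, hx x _ rfl⟩ ((x⁻¹ : G) : G ⧸ H).out⁻¹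
      have h2 := ψ.2 ⟨_, hx x _ rfl⟩ ((x⁻¹ : G) : G ⧸ H).out⁻¹
      simp only [Subgroup.coe_subtype, mul_inv_cancel_right] at h1 h2
      rw [h1, h2]
      exact congrArg _ (congrFun h _)
    -- A function on cosets extends to `G` by `x * i.out ∈ H`, where `i` is the coset of `x⁻¹`.
    · intro φ
      have hval (x : G) (i : G ⧸ H) (hi : ((x⁻¹ : G) : G ⧸ H) = i) :
          ρ ⟨_, hx x _ rfl⟩ (φ ((x⁻¹ : G) : G ⧸ H)) = ρ ⟨_, hx x i hi⟩ (φ i) := by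
        subst hi; rfl
      refine ⟨⟨fun x => ρ ⟨_, hx x _ rfl⟩ (φ ((x⁻¹ : G) : G ⧸ H)), fun s x => ?_⟩,
        funext fun i => ?_⟩
      · have hs : ((((s : G) * x)⁻¹ : G) : G ⧸ H) = ((x⁻¹ : G) : G ⧸ H) :=
          QuotientGroup.eq.2 (by simp)
        refine (hval (s * x) _ hs).trans ?_
        rw [← Module.End.mul_apply, ← map_mul]
        congr 2
        exact Subtype.ext (mul_assoc _ _ _)
      · refine (hval i.out⁻¹ i (by simp)).trans ?_
        have : (⟨_, hx i.out⁻¹ i (by simp)⟩ : H) = 1 := Subtype.ext (inv_mul_cancel _)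
        rw [this, map_one, Module.End.one_apply]
  refine ⟨e₁.toLinearEquiv.toEquiv.trans (Equiv.ofBijective f hf), fun g v i => ?_⟩
  have h1 : e₁ (ρ₁ g v) = Representation.coind H.subtype ρ g (e₁ v) := by
    exact LinearMap.congr_fun (e₁.isIntertwining' g) v
  change (e₁ (ρ₁ g v)).1 (g • i).out⁻¹ = ρ (transition H g i) ((e₁ v).1 i.out⁻¹)
  rw [h1, ← (e₁ v).2]
  change (e₁ v).1 ((g • i).out⁻¹ * g) = (e₁ v).1 ((g • i).out⁻¹ * (g * i.out) * i.out⁻¹)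
  simp [mul_assoc]

end Induced

/-! ### Orbits and commuting subgroups under induction -/

section BlockAction

variable {Q : Type u} {G : Type v} [Field Q] [Group G] [Finite G] {H : Subgroup G} {W V : Type w}
  [AddCommGroup W] [Module Q W] [AddCommGroup V] [Module Q V]
  {ρ₁ : Representation Q G V} {ρ : Representation Q H W}

lemma card_eq_pow_of_isInd (h : IsInd ρ₁ ρ) : Nat.card V = Nat.card W ^ H.index := by
  obtain ⟨e, -⟩ := exists_equiv_of_isInd h
  rw [Nat.card_congr e, Nat.card_fun, Subgroup.index]

/-- Elements of the block of the trivial coset that lie in one `G`-orbit lie in one `H`-orbit. -/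
lemma numOrbits_le_of_isInd [Finite V] (h : IsInd ρ₁ ρ) : numOrbits ρ ≤ numOrbits ρ₁ := by
  classical
  obtain ⟨e, he⟩ := exists_equiv_of_isInd h
  have hfin : (Set.range fun x : V => Set.range fun g : G => ρ₁ g x).Finite := Set.finite_range _
  have := hfin.to_subtype
  let i₀ : G ⧸ H := ((1 : G) : G ⧸ H)
  let ι : W → V := fun x => e.symm (Pi.single i₀ x)
  rw [numOrbits.eq_1 ρ₁, ← Nat.card_coe_set_eq]
  refine numOrbits_le_card ρ (fun x => (⟨_, ι x, rfl⟩ : Set.range _)) fun x y hxy => ?_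
  obtain ⟨g, hg⟩ := (range_orbit_eq_iff ρ₁).1 (congrArg Subtype.val hxy)
  have h1 := he g (ι x) i₀
  rw [hg] at h1
  simp only [ι, Equiv.apply_symm_apply, Pi.single_eq_same] at h1
  by_cases hi : g • i₀ = i₀
  · exact ⟨_, by rw [← h1, hi, Pi.single_eq_same]⟩
  -- If `g` moves the block, then both elements vanish.
  · rw [Pi.single_eq_of_ne hi] at h1
    have hx : x = 0 := by
      have := congrArg (ρ (transition H g i₀)⁻¹) h1
      simpa [← Module.End.mul_apply, ← map_mul] using this.symm
    have hy : ι x = ι y := by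
      rw [← hg]
      apply e.injective
      ext j
      obtain ⟨k, rfl⟩ : ∃ k, j = g • k := ⟨g⁻¹ • j, by simp⟩
      rw [he]
      simp [ι, hx]
    have := congrFun (e.symm.injective hy) i₀
    simp only [Pi.single_eq_same] at this
    exact ⟨1, by simp [this]⟩

/-- The number of blocks in which a vector has a non-zero component is an invariant of its orbit,
and takes all values from `0` to the index of `H`. -/
lemma index_lt_numOrbits_of_isInd [Finite V] [Nontrivial W] (h : IsInd ρ₁ ρ) :
    H.index + 1 ≤ numOrbits ρ₁ := by
  classical
  obtain ⟨e, he⟩ := exists_equiv_of_isInd h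
  have : Fintype (G ⧸ H) := Fintype.ofFinite _
  let wt : V → ℕ := fun v => {i | e v i ≠ 0}.ncard
  have hwt (g : G) (v : V) : wt (ρ₁ g v) = wt v := by
    symm
    refine Set.ncard_congr (fun i _ => g • i) (fun i hi => ?_) (fun i j _ _ hij => ?_)
      fun i hi => ?_
    · simp only [Set.mem_ofPred_eq, he] at hi ⊢
      intro h0
      apply hi
      have := congrArg (ρ (transition H g i)⁻¹) h0
      simpa [← Module.End.mul_apply, ← map_mul] using this
    · exact MulAction.injective g hij
    · refine ⟨g⁻¹ • i, ?_, by simp⟩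
      obtain ⟨k, rfl⟩ : ∃ k, i = g • k := ⟨g⁻¹ • i, by simp⟩
      simp only [Set.mem_ofPred_eq, he, inv_smul_smul] at hi ⊢
      exact fun h0 => hi (by simp [h0])
  refine le_trans ?_ (card_range_le_numOrbits ρ₁ wt hwt)
  obtain ⟨w, hw⟩ := exists_ne (0 : W)
  have hsub : (Finset.range (H.index + 1) : Set ℕ) ⊆ Set.range wt := by
    intro k hk
    have hk : k ≤ Finset.univ.card (α := G ⧸ H) := by
      rw [Finset.card_univ, ← Nat.card_eq_fintype_card]
      simpa [Subgroup.index, Nat.lt_succ_iff] using hk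
    obtain ⟨S, -, hS⟩ := Finset.exists_subset_card_eq hk
    refine ⟨e.symm fun i => if i ∈ S then w else 0, ?_⟩
    simp only [wt, Equiv.apply_symm_apply]
    rw [← hS, ← Set.ncard_coe_finset]
    congr 1
    ext i
    simp [hw]
  have := Set.ncard_le_ncard hsub (Set.finite_range _)
  rwa [Set.ncard_coe_finset, Finset.card_range] at this

/-- The subgroup consists of the elements that fix every block and act on it through `A`; a coset of
it is determined by a permutation of the blocks and a coset of `A` for each block. -/
lemma exists_commuting_subgroup_of_isInd (h : IsInd ρ₁ ρ) {A : Subgroup H}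
    (hA : ∀ a ∈ A, ∀ b ∈ A, Commute (ρ a) (ρ b)) :
    ∃ B : Subgroup G, (∀ a ∈ B, ∀ b ∈ B, Commute (ρ₁ a) (ρ₁ b)) ∧
      B.index ≤ A.index ^ H.index * H.index.factorial := by
  classical
  obtain ⟨e, he⟩ := exists_equiv_of_isInd h
  have : Fintype (G ⧸ H) := Fintype.ofFinite _
  let B : Subgroup G :=
    ⨅ i : G ⧸ H, (A.map H.subtype).comap (MulAut.conj i.out⁻¹).toMonoidHom
  have hB (g : G) : g ∈ B ↔ ∀ i : G ⧸ H, ∃ a ∈ A, (a : G) = i.out⁻¹ * (g * i.out) := by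
    simp [B, Subgroup.mem_iInf, mul_assoc]
  have hfix (g : G) (hg : g ∈ B) (i : G ⧸ H) : g • i = i ∧ transition H g i ∈ A := by
    obtain ⟨a, ha, hai⟩ := (hB g).1 hg i
    have h1 : g • i = i := by
      conv_rhs => rw [← i.out_eq']
      conv_lhs => rw [← i.out_eq', MulAction.Quotient.smul_coe]
      refine (QuotientGroup.eq.2 ?_).symm
      rw [smul_eq_mul, ← hai]
      exact a.2
    refine ⟨h1, ?_⟩
    have : transition H g i = a := Subtype.ext (by simp only [transition, h1, hai])
    rwa [this]
  refine ⟨B, fun a ha b hb => LinearMap.ext fun v => e.injective (funext fun i => ?_), ?_⟩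
  · have h1 (g : G) (hg : g ∈ B) (v : V) : e (ρ₁ g v) i = ρ (transition H g i) (e v i) := by
      conv_lhs => rw [← (hfix g hg i).1]
      exact he g v i
    simp only [Module.End.mul_apply, h1 a ha, h1 b hb]
    exact LinearMap.congr_fun (hA _ (hfix a ha i).2 _ (hfix b hb i).2) _
  · have hcard : Nat.card (Equiv.Perm (G ⧸ H) × (G ⧸ H → H ⧸ A)) =
        A.index ^ H.index * H.index.factorial := by
      rw [Nat.card_prod, Nat.card_perm, Nat.card_fun, mul_comm]
      rfl
    rw [← hcard]
    refine B.index_le_card_of_map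
      (fun g => (MulAction.toPerm g, fun i => (transition H g i : H ⧸ A))) fun g g' hgg => ?_
    rw [Prod.mk.injEq] at hgg
    refine (hB _).2 fun i => ⟨_, QuotientGroup.eq.1 (congrFun hgg.2 i), ?_⟩
    have h2 : g • i = g' • i := Equiv.congr_fun hgg.1 i
    simp [transition, h2, mul_assoc]

end BlockAction

/-! ### Orbits and commuting subgroups under semilinear extension -/

section Semilinear

variable {Q₁ Q : Type u} {H₁ H : Type v} {W : Type w} [Field Q₁] [Field Q] [Algebra Q₁ Q]
  [Group H₁] [Group H] [AddCommGroup W] [Module Q₁ W] [Module Q W]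
  {ρ₁ : Representation Q₁ H₁ W} {ρ : Representation Q H W}

lemma card_algEquiv_le_finrank (Q₁ Q : Type*) [Field Q₁] [Field Q] [Algebra Q₁ Q] [Finite Q] :
    Nat.card (Q ≃ₐ[Q₁] Q) ≤ Module.finrank Q₁ Q := by
  have : Module.Finite Q₁ Q := Module.Finite.of_finite
  rw [Nat.card_eq_fintype_card]
  exact AlgEquiv.card_le (F := Q₁) (K := Q)

lemma IsStab.exists_eq_of_linear [IsScalarTower Q₁ Q W] (h : IsStab Q₁ Q ρ₁ ρ) (g : H₁)
    (hg : ∀ (a : Q) (x : W), ρ₁ g (a • x) = a • ρ₁ g x) : ∃ k : H, ∀ x, ρ k x = ρ₁ g x := by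
  let T : Module.End Q W := { toFun := ρ₁ g, map_add' := map_add _, map_smul' := hg }
  obtain ⟨k, hk⟩ := (h.2 T).1 ⟨g, rfl⟩
  exact ⟨k, fun x => by rw [hk]; rfl⟩

lemma inv_semilinear {τ : Q ≃ₐ[Q₁] Q} {g : H₁}
    (hg : ∀ (a : Q) (x : W), ρ₁ g (a • x) = τ a • ρ₁ g x) (a : Q) (x : W) :
    ρ₁ g⁻¹ (τ a • x) = a • ρ₁ g⁻¹ x := by
  have h1 : ρ₁ g (ρ₁ g⁻¹ x) = x := by simp [← Module.End.mul_apply, ← map_mul]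
  have h2 : ρ₁ g⁻¹ (ρ₁ g (a • ρ₁ g⁻¹ x)) = a • ρ₁ g⁻¹ x := by
    simp [← Module.End.mul_apply, ← map_mul]
  rwa [hg, h1] at h2

/-- An element of `H₁` taking a fixed base point of an `H₁`-orbit to `x` has a field automorphism,
and elements with equal automorphisms differ by a `Q`-linear one. So each `H₁`-orbit splits into at
most `[Q : Q₁]` orbits of `H`. -/
lemma IsStab.numOrbits_le [IsScalarTower Q₁ Q W] [Finite Q] [Finite W] (h : IsStab Q₁ Q ρ₁ ρ) :
    numOrbits ρ ≤ numOrbits ρ₁ * Module.finrank Q₁ Q := by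
  have : Module.Finite Q₁ Q := Module.Finite.of_finite
  choose τ hτ using h.1
  have hfin : (Set.range fun x : W => Set.range fun g : H₁ => ρ₁ g x).Finite := Set.finite_range _
  have := hfin.to_subtype
  let O : W → Set.range (fun x : W => Set.range fun g : H₁ => ρ₁ g x) := fun x => ⟨_, x, rfl⟩
  have hrep (x : W) : ∃ g : H₁, ρ₁ g (O x).2.choose = x :=
    (range_orbit_eq_iff ρ₁).1 (O x).2.choose_spec
  choose g hg using hrep
  refine (numOrbits_le_card ρ (fun x => (O x, τ (g x))) fun x y hxy => ?_).trans
    (le_of_eq_of_le (Nat.card_prod _ _) (Nat.mul_le_mul ?_ (card_algEquiv_le_finrank Q₁ Q)))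
  · rw [Prod.mk.injEq] at hxy
    have hlin (a : Q) (z : W) : ρ₁ (g y * (g x)⁻¹) (a • z) = a • ρ₁ (g y * (g x)⁻¹) z := by
      obtain ⟨b, rfl⟩ := (τ (g x)).surjective a
      rw [map_mul, Module.End.mul_apply, Module.End.mul_apply, inv_semilinear (hτ (g x)), hτ,
        hxy.2]
    obtain ⟨k, hk⟩ := h.exists_eq_of_linear _ hlin
    refine ⟨k, ?_⟩
    rw [hk, ← hg x]
    conv_rhs => rw [← hg y, ← hxy.1]
    rw [← Module.End.mul_apply, ← map_mul, hg x]
    simp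
  · rw [numOrbits, Nat.card_coe_set_eq]

/-- The subgroup consists of the elements of `H₁` that act as elements of `A`. The coset of `g` is
determined by the field automorphism of `g`, and, once a group element `r` with that automorphism
is divided out, by the coset of `A` of an element acting as the `Q`-linear map `r⁻¹ g`. -/
lemma IsStab.exists_commuting_subgroup [IsScalarTower Q₁ Q W] [Finite Q] [Finite H]
    (h : IsStab Q₁ Q ρ₁ ρ) {A : Subgroup H}
    (hA : ∀ a ∈ A, ∀ b ∈ A, Commute (ρ a) (ρ b)) :
    ∃ B : Subgroup H₁, (∀ a ∈ B, ∀ b ∈ B, Commute (ρ₁ a) (ρ₁ b)) ∧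
      B.index ≤ Module.finrank Q₁ Q * A.index := by
  have : Module.Finite Q₁ Q := Module.Finite.of_finite
  choose τ hτ using h.1
  let B : Subgroup H₁ :=
    { carrier := {g | ∃ a ∈ A, ∀ x, ρ a x = ρ₁ g x}
      mul_mem' := by
        rintro g g' ⟨a, ha, hag⟩ ⟨b, hb, hbg⟩
        exact ⟨a * b, A.mul_mem ha hb, fun x => by simp [hag, hbg]⟩
      one_mem' := ⟨1, A.one_mem, fun x => by simp⟩
      inv_mem' := by
        rintro g ⟨a, ha, hag⟩
        refine ⟨a⁻¹, A.inv_mem ha, fun x => ?_⟩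
        have h1 : ρ a (ρ₁ g⁻¹ x) = x := by
          rw [hag]; simp [← Module.End.mul_apply, ← map_mul]
        have h2 : ρ a⁻¹ (ρ a (ρ₁ g⁻¹ x)) = ρ₁ g⁻¹ x := by
          simp [← Module.End.mul_apply, ← map_mul]
        rwa [h1] at h2 }
  refine ⟨B, ?_, ?_⟩
  · rintro g ⟨a, ha, hag⟩ g' ⟨b, hb, hbg⟩
    ext x
    have := LinearMap.congr_fun (hA a ha b hb) x
    simpa [hag, hbg] using this
  · let r : (Q ≃ₐ[Q₁] Q) → H₁ := Function.invFun τ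
    have hr (g : H₁) : τ (r (τ g)) = τ g := Function.invFun_eq ⟨g, rfl⟩
    have hlin (g : H₁) (a : Q) (z : W) :
        ρ₁ ((r (τ g))⁻¹ * g) (a • z) = a • ρ₁ ((r (τ g))⁻¹ * g) z := by
      rw [map_mul, Module.End.mul_apply, Module.End.mul_apply, hτ]
      exact inv_semilinear (fun a x => by rw [hτ, hr]) _ _
    choose k hk using fun g => h.exists_eq_of_linear _ (hlin g)
    refine le_trans (B.index_le_card_of_map (fun g => (τ g, (k g : H ⧸ A))) fun g g' hgg => ?_)
      (le_of_eq_of_le (Nat.card_prod _ _) (Nat.mul_le_mul_right _ (card_algEquiv_le_finrank Q₁ Q)))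
    rw [Prod.mk.injEq] at hgg
    refine ⟨_, QuotientGroup.eq.1 hgg.2, fun x => ?_⟩
    have h1 : ρ (k g) (ρ₁ (g⁻¹ * g') x) = ρ (k g') x := by
      rw [hk, hk, hgg.1, ← Module.End.mul_apply, ← map_mul]
      simp [mul_assoc]
    rw [map_mul, Module.End.mul_apply, ← h1, ρ.inv_self_apply]

end Semilinear

/-! ### Induction along the construction -/

lemma commute_end_of_card_eq {Q : Type u} {W : Type w} [Field Q] [Finite Q] [AddCommGroup W]
    [Module Q W] (h : Nat.card W = Nat.card Q) (S T : Module.End Q W) : Commute S T := by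
  have : Finite W := Nat.finite_of_card_ne_zero (h ▸ Nat.card_pos.ne')
  have : Module.Finite Q W := Module.Finite.of_finite
  have h1 : Module.finrank Q W = 1 := by
    rw [Module.natCard_eq_pow_finrank (K := Q)] at h
    exact Nat.pow_right_injective Finite.one_lt_card (h.trans (pow_one _).symm)
  obtain ⟨x, hx, hspan⟩ := finrank_eq_one_iff'.1 h1
  obtain ⟨s, hs⟩ := hspan (S x)
  obtain ⟨t, ht⟩ := hspan (T x)
  refine LinearMap.ext fun y => ?_
  obtain ⟨c, rfl⟩ := hspan y
  simp only [Module.End.mul_apply, map_smul, ← hs, ← ht]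
  rw [smul_comm s t]

/-- Some subgroup `A` of `H` acts on `W` by commuting maps and satisfies
`4 |Q| |H : A|² ≤ |W|`, that is, `|H : A| ≤ |W|^(1/2) / (2 |Q|^(1/2))`. The condition is about the
action of `A`, so that it makes sense for modules that are not faithful. -/
def HasLargeCommutingSubgroup {Q : Type u} {H : Type v} {W : Type w} [Field Q] [Group H]
    [AddCommGroup W] [Module Q W] (ρ : Representation Q H W) : Prop :=
  ∃ A : Subgroup H, (∀ a ∈ A, ∀ b ∈ A, Commute (ρ a) (ρ b)) ∧
    4 * Nat.card Q * A.index ^ 2 ≤ Nat.card W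

/-- The orbit hypothesis is the integral form of `n(H, W) < 2 √(|Q| - 1)`, and `|W| = |Q|` says that
`W` is one-dimensional. -/
theorem card_eq_or_hasLargeCommutingSubgroup {F : Type u} [Field F]
    (hF : 59 ≤ Nat.card F) (Q : Type u) [Field Q] [Algebra F Q] {H : Type v} [Group H]
    {W : Type w} [AddCommGroup W] [Module Q W] (ρ : Representation Q H W)
    (h : Obtainable F Q ρ) :
    Finite Q ∧ Finite H ∧ Finite W ∧ (numOrbits ρ ^ 2 + 4 < 4 * Nat.card Q →
      Nat.card W = Nat.card Q ∨ HasLargeCommutingSubgroup ρ) := by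
  induction h with
  | line Q ρ hcop hdim =>
    have : Module.Finite Q _ := Module.finite_of_finrank_eq_succ hdim
    refine ⟨‹_›, ‹_›, Module.finite_of_finite Q, fun _ => Or.inl ?_⟩
    rw [Module.natCard_eq_pow_finrank (K := Q), hdim, pow_one]
  | stab Q₁ Q ρ₁ ρ hcop hstab h ih =>
    obtain ⟨hQ, hH, hW, ih⟩ := ih
    have hQ₁ : Finite Q₁ := Finite.of_injective _ (algebraMap Q₁ Q).injective
    refine ⟨hQ₁, ‹_›, hW, fun hn => ?_⟩
    have : Module.Finite Q₁ Q := Module.Finite.of_finite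
    have hc₁ : 59 ≤ Nat.card Q₁ :=
      hF.trans (Nat.card_le_card_of_injective _ (algebraMap F Q₁).injective)
    have hc : Nat.card Q = Nat.card Q₁ ^ Module.finrank Q₁ Q := Module.natCard_eq_pow_finrank
    have hd : 1 ≤ Module.finrank Q₁ Q := Module.finrank_pos
    have horb := hstab.numOrbits_le
    have hnQ : numOrbits ρ ^ 2 + 4 < 4 * Nat.card Q := by
      obtain ⟨C, hC⟩ : ∃ C, Nat.card Q₁ = C + 1 := ⟨Nat.card Q₁ - 1, by omega⟩
      have h1 := sq_mul_le_pow (C := C) (by omega) (Module.finrank Q₁ Q)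
      rw [hC] at hn
      rw [hc, hC]
      have h2 : numOrbits ρ ^ 2 ≤ (numOrbits ρ₁ * Module.finrank Q₁ Q) ^ 2 := by gcongr
      have h3 : (numOrbits ρ₁ ^ 2 + 1) * Module.finrank Q₁ Q ^ 2 ≤
          (4 * C) * Module.finrank Q₁ Q ^ 2 := by gcongr; omega
      nlinarith
    obtain ⟨s, hs⟩ : ∃ s, Module.finrank Q₁ Q = s + 1 := ⟨Module.finrank Q₁ Q - 1, by omega⟩
    rcases ih hnQ with hline | ⟨A, hA, hAi⟩
    · rcases Nat.lt_or_ge (Module.finrank Q₁ Q) 2 with h1 | h2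
      · left
        rw [hline, hc, show Module.finrank Q₁ Q = 1 by omega, pow_one]
      · right
        obtain ⟨B, hB, hBi⟩ := hstab.exists_commuting_subgroup (A := ⊤)
          fun a _ b _ => commute_end_of_card_eq hline _ _
        rw [Subgroup.index_top, mul_one] at hBi
        refine ⟨B, hB, ?_⟩
        have h4 := four_mul_sq_le_pow_pred (c := Nat.card Q₁) (by omega) h2
        rw [hs, Nat.add_sub_cancel] at h4
        rw [hs] at hBi
        rw [hline, hc, hs, pow_succ' (Nat.card Q₁)]
        calc 4 * Nat.card Q₁ * B.index ^ 2 ≤ 4 * Nat.card Q₁ * (s + 1) ^ 2 := by gcongr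
          _ = Nat.card Q₁ * (4 * (s + 1) ^ 2) := by ring
          _ ≤ _ := by gcongr
    · obtain ⟨B, hB, hBi⟩ := hstab.exists_commuting_subgroup hA
      refine Or.inr ⟨B, hB, ?_⟩
      have h4 := sq_le_pow_pred (c := Nat.card Q₁) (by omega) hd
      rw [hs, Nat.add_sub_cancel] at h4
      rw [hs] at hBi
      rw [hc, hs, pow_succ' (Nat.card Q₁)] at hAi
      calc 4 * Nat.card Q₁ * B.index ^ 2
          ≤ 4 * Nat.card Q₁ * ((s + 1) * A.index) ^ 2 := by gcongr
        _ = 4 * (Nat.card Q₁ * (s + 1) ^ 2) * A.index ^ 2 := by ring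
        _ ≤ 4 * (Nat.card Q₁ * Nat.card Q₁ ^ s) * A.index ^ 2 := by gcongr
        _ ≤ _ := hAi
  | @ind Q _ _ H₁ _ _ H W₁ W _ _ _ _ ρ₁ ρ hcop hind h ih =>
    obtain ⟨hQ, hH, hW, ih⟩ := ih
    have hcard := card_eq_pow_of_isInd hind
    have hW₁ : Finite W₁ :=
      Nat.finite_of_card_ne_zero (by rw [hcard]; exact pow_ne_zero _ Nat.card_pos.ne')
    refine ⟨hQ, ‹_›, hW₁, fun hn => ?_⟩
    have hc : 59 ≤ Nat.card Q :=
      hF.trans (Nat.card_le_card_of_injective _ (algebraMap F Q).injective)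
    have horb := numOrbits_le_of_isInd hind
    have ih := ih (lt_of_le_of_lt (by gcongr) hn)
    have : Nontrivial W := by
      rw [← Finite.one_lt_card_iff_nontrivial]
      rcases ih with h1 | ⟨A, -, hA⟩
      · omega
      · have := Nat.pos_of_ne_zero A.index_ne_zero_of_finite
        nlinarith
    have ht : (H.index + 1) ^ 2 + 4 < 4 * Nat.card Q :=
      lt_of_le_of_lt (by gcongr; exact index_lt_numOrbits_of_isInd hind) hn
    have ht0 := Nat.pos_of_ne_zero H.index_ne_zero_of_finite
    obtain ⟨s, hs⟩ : ∃ s, H.index = s + 1 := ⟨H.index - 1, by omega⟩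
    rcases ih with hline | ⟨A, hA, hAi⟩
    · rcases Nat.lt_or_ge H.index 2 with h1 | h2
      · left
        rw [hcard, hline, show H.index = 1 by omega, pow_one]
      · right
        obtain ⟨B, hB, hBi⟩ := exists_commuting_subgroup_of_isInd hind (A := ⊤)
          fun a _ b _ => commute_end_of_card_eq hline _ _
        rw [Subgroup.index_top, one_pow, one_mul] at hBi
        refine ⟨B, hB, ?_⟩
        have h4 := four_mul_sq_factorial_le h2 hc ht
        rw [hcard, hline, hs, pow_succ' (Nat.card Q)]
        rw [hs, Nat.add_sub_cancel] at h4
        rw [hs] at hBi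
        calc 4 * Nat.card Q * B.index ^ 2 ≤ 4 * Nat.card Q * (s + 1).factorial ^ 2 := by gcongr
          _ = Nat.card Q * (4 * (s + 1).factorial ^ 2) := by ring
          _ ≤ _ := by gcongr
    · obtain ⟨B, hB, hBi⟩ := exists_commuting_subgroup_of_isInd hind hA
      refine Or.inr ⟨B, hB, ?_⟩
      have h4 := sq_factorial_le ht
      rw [hs, Nat.add_sub_cancel] at h4
      rw [hs] at hBi
      rw [hcard, hs]
      calc 4 * Nat.card Q * B.index ^ 2
          ≤ 4 * Nat.card Q * (A.index ^ (s + 1) * (s + 1).factorial) ^ 2 := by gcongr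
        _ = 4 * Nat.card Q * (A.index ^ (s + 1)) ^ 2 * (s + 1).factorial ^ 2 := by ring
        _ ≤ 4 * Nat.card Q * (A.index ^ (s + 1)) ^ 2 * (4 * Nat.card Q) ^ s := by gcongr
        _ = (4 * Nat.card Q * A.index ^ 2) ^ (s + 1) := by
            rw [mul_pow _ (A.index ^ 2), pow_succ (4 * Nat.card Q) s, ← pow_mul, ← pow_mul,
              mul_comm 2]
            ring
        _ ≤ _ := by gcongr

/-- A line is induced from itself, the subgroup being the whole group. -/
lemma isInducedFromLine_of_finrank_eq_one {F : Type u} {G : Type v} {V : Type w} [Field F]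
    [Group G] [AddCommGroup V] [Module F V] (ρ : Representation F G V)
    (h : Module.finrank F V = 1) : IsInducedFromLine ρ := by
  let σ : Representation F (⊤ : Subgroup G) V := ρ.comp (Subgroup.subtype ⊤)
  refine ⟨⊤, V, _, _, σ, h, ⟨Representation.Equiv.symm ((indEquivCoind σ).trans ?_)⟩⟩
  refine .mk (.ofBijective ((LinearMap.proj 1).comp (Representation.coindV _ σ).subtype)
    ⟨fun φ ψ hφ => ?_, fun x => ?_⟩) fun g => LinearMap.ext fun φ => ?_
  · refine Subtype.ext (funext fun g => ?_)
    have h1 := φ.2 ⟨g, trivial⟩ 1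
    have h2 := ψ.2 ⟨g, trivial⟩ 1
    simp only [Subgroup.coe_subtype, mul_one] at h1 h2
    rw [h1, h2]
    exact congrArg _ hφ
  · exact ⟨⟨fun g => ρ g x, fun g k => by simp [σ]⟩, by simp⟩
  · have h1 := φ.2 ⟨g, trivial⟩ 1
    change φ.1 (1 * g) = ρ g (φ.1 1)
    rw [one_mul, ← mul_one g]
    simpa [σ] using h1

theorem lemma4p2 {F : Type u} {G : Type v} {V : Type w} [Field F] [Finite F] [Group G] [Finite G]
    [AddCommGroup V] [Module F V] (ρ : Representation F G V) (p : ℕ) [CharP F p]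
    (hC : InClassC ρ) (horb : (numOrbits ρ : ℝ) < 2 * √((Nat.card F : ℝ) - 1)) (hp : 59 ≤ p) :
    (∃ A : Subgroup G, IsMulCommutative A ∧
        (A.index : ℝ) ≤ √(Nat.card V : ℝ) / (2 * √((p : ℝ) - 1))) ∨
      (Nat.card F = p ∧ IsInducedFromLine ρ ∧
        (∃ (N : Subgroup G) (_ : N.Normal),
          Nonempty (G ⧸ N ≃* alternatingGroup (Fin (Module.finrank F V))) ∨
            Nonempty (G ⧸ N ≃* Equiv.Perm (Fin (Module.finrank F V)))) ∧
        (Module.finrank F V = 1 ∨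
          (15 ≤ Module.finrank F V ∧ Module.finrank F V ≤ 180 ∧ p < 8192))) := by
  have hV := hC.finite
  have : Module.Finite F V := Module.Finite.of_finite
  have := Fintype.ofFinite F
  obtain ⟨k, -, hk⟩ := FiniteField.card F p
  rw [← Nat.card_eq_fintype_card] at hk
  have hpF : p ≤ Nat.card F := hk ▸ Nat.le_self_pow k.ne_zero p
  have hn : numOrbits ρ ^ 2 + 4 < 4 * Nat.card F := by
    have h0 : (0 : ℝ) ≤ (Nat.card F : ℝ) - 1 := by
      have : (59 : ℝ) ≤ Nat.card F := by exact_mod_cast hp.trans hpF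
      linarith
    have h1 : (numOrbits ρ : ℝ) ^ 2 < (2 * √((Nat.card F : ℝ) - 1)) ^ 2 := by gcongr
    rw [mul_pow, Real.sq_sqrt h0] at h1
    have h2 : ((numOrbits ρ ^ 2 + 4 : ℕ) : ℝ) < ((4 * Nat.card F : ℕ) : ℝ) := by
      push_cast; linarith
    exact_mod_cast h2
  have key (A : Subgroup G) (hA : ∀ a ∈ A, ∀ b ∈ A, Commute (ρ a) (ρ b))
      (hi : 4 * p * A.index ^ 2 ≤ Nat.card V) : ∃ A : Subgroup G, IsMulCommutative A ∧
        (A.index : ℝ) ≤ √(Nat.card V : ℝ) / (2 * √((p : ℝ) - 1)) := by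
    refine ⟨A, ⟨⟨fun a b => Subtype.ext (hC.faithful ?_)⟩⟩, ?_⟩
    · simpa using (hA a a.2 b b.2).eq
    · have hp1 : (0 : ℝ) < (p : ℝ) - 1 := by
        have : (59 : ℝ) ≤ p := by exact_mod_cast hp
        linarith
      rw [le_div_iff₀ (by positivity)]
      refine Real.le_sqrt_of_sq_le ?_
      rw [mul_pow, mul_pow, Real.sq_sqrt hp1.le]
      have : (4 * p * A.index ^ 2 : ℝ) ≤ Nat.card V := by exact_mod_cast hi
      nlinarith [sq_nonneg (A.index : ℝ)]
  obtain ⟨-, -, -, hmain⟩ :=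
    card_eq_or_hasLargeCommutingSubgroup (hp.trans hpF) F ρ hC.obtainable
  rcases hmain hn with hline | ⟨A, hA, hAi⟩
  · by_cases hFp : Nat.card F = p
    · right
      have h1 : Module.finrank F V = 1 := by
        rw [Module.natCard_eq_pow_finrank (K := F)] at hline
        exact Nat.pow_right_injective Finite.one_lt_card (hline.trans (pow_one _).symm)
      refine ⟨hFp, isInducedFromLine_of_finrank_eq_one ρ h1, ⟨⊤, inferInstance, Or.inr ?_⟩,
        Or.inl h1⟩
      rw [h1]
      have : Subsingleton (G ⧸ (⊤ : Subgroup G)) := QuotientGroup.subsingleton_quotient_top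
      have := uniqueOfSubsingleton (1 : G ⧸ (⊤ : Subgroup G))
      exact ⟨MulEquiv.ofUnique⟩
    -- `V` is a line over a field with at least `p²` elements, and `G` itself is abelian.
    · left
      refine key ⊤ (fun a _ b _ => commute_end_of_card_eq hline _ _) ?_
      have hk2 : 2 ≤ (k : ℕ) := by
        have := k.pos
        by_contra hlt
        exact hFp (by rw [hk, show (k : ℕ) = 1 by omega, pow_one])
      rw [Subgroup.index_top, hline, hk]
      calc 4 * p * 1 ^ 2 ≤ p ^ 2 := by nlinarith
        _ ≤ _ := Nat.pow_le_pow_right (by omega) hk2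
  · exact Or.inl (key A hA (le_trans (by gcongr) hAi))
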